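/- Let $n,m\ge 0$ be integers, let $p\in\mathbb{R}[x_1,\dots,x_n]$, put $X=\{x\in\mathbb{R}^n : p(x)\ge 0\}$, and let $\mathcal{A}=\mathbb{R}[x,\sqrt{p(x)}]$ be the algebra of real-valued functions on $X$ generated by the coordinate functions $x_1,\dots,x_n$ and $\sqrt{p}$. Let $g_1,\dots,g_m\in\mathcal{A}$ (for example, restrictions to $X$ of polynomials in $x$), let $g_{m+1}=p$, and let $$K'=\{x\in\mathbb{R}^n : p(x)\ge 0,\ g_1(x)\ge 0,\dots,g_m(x)\ge 0\}=\{x\in X : g_j(x)\ge 0,\ j=1,\dots,m+1\}.$$ Let $M\in\mathbb{R}$ be such that $M-\|x\|^2-p(x)>0$ for all $x\in K'$, where $\|\cdot\|$ is the Euclidean norm (in particular, $K'$ is compact). If $f\in\mathcal{A}$ satisfies $f(x)>0$ for all $x\in K'$, then there are sums of squares of polynomials $\sigma,\sigma_0,\phi,\psi_1,\dots,\psi_{m+1}\in\Sigma\,\mathbb{R}[y_1,\dots,y_{n+1}]^2$ such that, for all $x\in X$, $$f(x)=\sigma(x,\sqrt{p(x)})+\bigl(M-\|x\|^2-p(x)\bigr)\,\sigma_0(x,\sqrt{p(x)})+\sum_{j=1}^{m+1}g_j(x)\,\psi_j(x,\sqrt{p(x)})+\sqrt{p(x)}\,\phi(x,\sqrt{p(x)}).$$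 -/

import Mathlib

namespace SqrtAlgebra

noncomputable section

/-- The set `X = {x ∈ ℝⁿ : p(x) ≥ 0}` on which `√p` is defined. -/
abbrev Domain {n : ℕ} (p : MvPolynomial (Fin n) ℝ) : Type :=
  {x : EuclideanSpace ℝ (Fin n) // 0 ≤ MvPolynomial.eval (fun i => x i) p}

/-- The polynomial `p` as a real valued function on `X`. -/
def polyFun {n : ℕ} (p : MvPolynomial (Fin n) ℝ) : Domain p → ℝ :=
  fun x => MvPolynomial.eval (fun i => x.1 i) p

/-- The functions `x₁, …, xₙ, √p(x)` on `X`, in this order. -/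
def generators {n : ℕ} (p : MvPolynomial (Fin n) ℝ) : Fin (n + 1) → Domain p → ℝ :=
  Fin.snoc (α := fun _ => Domain p → ℝ) (fun i x => x.1 i) (fun x => Real.sqrt (polyFun p x))

/-- The algebra `ℝ[x, √p(x)]` of real valued functions on `X`. -/
def sqrtAlgebra {n : ℕ} (p : MvPolynomial (Fin n) ℝ) : Subalgebra ℝ (Domain p → ℝ) :=
  Algebra.adjoin ℝ (Set.range (generators p))

/-- The value `q(x, √p(x))` of a polynomial `q ∈ ℝ[y₁, …, yₙ₊₁]`. -/
def subst {n : ℕ} (p : MvPolynomial (Fin n) ℝ) (q : MvPolynomial (Fin (n + 1)) ℝ)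
    (x : Domain p) : ℝ :=
  MvPolynomial.eval (fun i => generators p i x) q

/-- The constraint functions `g₁, …, gₘ` followed by `gₘ₊₁ = p`. -/
def constraints {n m : ℕ} (p : MvPolynomial (Fin n) ℝ) (g : Fin m → Domain p → ℝ) :
    Fin (m + 1) → Domain p → ℝ :=
  Fin.snoc (α := fun _ => Domain p → ℝ) g (polyFun p)

/-- The set `K' = K ∩ {p ≥ 0}`, that is, the set of all `x` with `gⱼ(x) ≥ 0` for
`j = 1, …, m + 1`. -/
def constraintSet {n m : ℕ} (p : MvPolynomial (Fin n) ℝ) (g : Fin m → Domain p → ℝ) :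
    Set (Domain p) :=
  {x | ∀ j, 0 ≤ constraints p g j x}

end

end SqrtAlgebra

/-! Let `Q` be the set of polynomials in y₁, …, yₙ₊₁ whose substitution y = (x, √p(x)) has a
representation of the required form. It is a quadratic module, and it is Archimedean because M - ∑
yᵢ² substitutes to M - ‖x‖² - p. A character χ nonnegative on `Q` is evaluation at some point (a,
b). The polynomial yₙ₊₁² - p and its negative vanish after substitution, so both lie in `Q` and b² =
p(a); also yₙ₊₁ ∈ `Q`, so b = √p(a). The lifts of the constraints lie in `Q`, hence a ∈ K'. So a
lift of f is positive at every such character, and the Archimedean Positivstellensatz puts it in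
`Q`.

The Positivstellensatz is proved by convexity. An element outside `Q` is nonpositive at some state
(Riesz extension). States form a compact set, so the minimum is attained at an extreme state
(Krein–Milman), and extreme states are multiplicative. This last point rests on the domination
ℓ(s²q) ≤ ρ ℓ(q) of `map_sq_mul_le`. -/

/-- A quadratic module of a commutative real algebra: a convex cone containing `1` that is stable
under multiplication by squares. -/
structure IsQuadraticModule {A : Type*} [CommRing A] [Algebra ℝ A] (Q : PointedCone ℝ A) :
    Prop where
  one_mem : (1 : A) ∈ Q
  mul_self_mul_mem : ∀ a : A, ∀ q ∈ Q, a * a * q ∈ Q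

/-- A cone is Archimedean if every element is bounded above by a real constant. -/
def IsArchimedeanCone {A : Type*} [CommRing A] [Algebra ℝ A] (Q : PointedCone ℝ A) : Prop :=
  ∀ a : A, ∃ c : ℝ, c • (1 : A) - a ∈ Q

/-- The states of a cone: the normalized linear functionals which are nonnegative on it. -/
def stateSet {A : Type*} [CommRing A] [Algebra ℝ A] (Q : PointedCone ℝ A) : Set (A → ℝ) :=
  {L | (∀ a b, L (a + b) = L a + L b) ∧ (∀ (c : ℝ) a, L (c • a) = c * L a) ∧
    L 1 = 1 ∧ ∀ q ∈ Q, 0 ≤ L q}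

/-- In a log-convex nonnegative sequence, geometric growth of rate `ρ` bounds the first ratio. -/
theorem le_mul_of_logConvex {u : ℕ → ℝ} {N ρ : ℝ} (hρ : 0 < ρ) (hu : ∀ k, 0 ≤ u k)
    (hlog : ∀ k, u (k + 1) * u (k + 1) ≤ u k * u (k + 2)) (hN : ∀ k, u k ≤ N * ρ ^ k) :
    u 1 ≤ ρ * u 0 := by
  by_contra! hlt
  have h0 : 0 < u 0 := by
    rcases (hu 0).lt_or_eq with h | h
    · exact h
    · have := hlog 0
      rw [← h] at this hlt
      simp only [mul_zero] at hlt
      nlinarith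
  -- Log-convexity makes successive ratios nondecreasing, so `u` grows at least like `r ^ k`, which
  -- beats `N * ρ ^ k` if `r > ρ`.
  set r := u 1 / u 0 with hr
  have hrρ : ρ < r := by rwa [hr, lt_div_iff₀ h0]
  have hr0 : 0 < r := hρ.trans hrρ
  have key : ∀ k, 0 < u k ∧ r * u k ≤ u (k + 1) := by
    intro k
    induction k with
    | zero => exact ⟨h0, le_of_eq (by rw [hr]; field_simp)⟩
    | succ k ih =>
      have hpos : 0 < u (k + 1) := (mul_pos hr0 ih.1).trans_le ih.2
      refine ⟨hpos, ?_⟩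
      have h1 : u k * (r * u (k + 1)) ≤ u k * u (k + 2) :=
        calc u k * (r * u (k + 1)) = r * u k * u (k + 1) := by ring
          _ ≤ u (k + 1) * u (k + 1) := mul_le_mul_of_nonneg_right ih.2 hpos.le
          _ ≤ _ := hlog k
      exact le_of_mul_le_mul_left h1 ih.1
  have geo : ∀ k, r ^ k * u 0 ≤ u k := by
    intro k
    induction k with
    | zero => simp
    | succ k ih =>
      calc r ^ (k + 1) * u 0 = r * (r ^ k * u 0) := by ring
        _ ≤ r * u k := mul_le_mul_of_nonneg_left ih hr0.le
        _ ≤ _ := (key k).2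
  obtain ⟨k, hk⟩ := pow_unbounded_of_one_lt (N / u 0) ((one_lt_div hρ).2 hrρ)
  rw [div_pow, div_lt_div_iff₀ h0 (pow_pos hρ k)] at hk
  exact absurd ((geo k).trans (hN k)) (not_le.2 hk)

/-! ### Quadratic modules in commutative real algebras. -/

section QuadraticModule

variable {A : Type*} [CommRing A] [Algebra ℝ A] {Q : PointedCone ℝ A}

theorem smul_mem_cone {c : ℝ} (hc : 0 ≤ c) {a : A} (ha : a ∈ Q) : c • a ∈ Q :=
  Q.smul_mem hc ha

theorem IsQuadraticModule.mul_self_mem (hQ : IsQuadraticModule Q) (a : A) : a * a ∈ Q := by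
  simpa using hQ.mul_self_mul_mem a 1 hQ.one_mem

theorem IsQuadraticModule.smul_one_mem (hQ : IsQuadraticModule Q) {c : ℝ} (hc : 0 ≤ c) :
    c • (1 : A) ∈ Q :=
  smul_mem_cone hc hQ.one_mem

theorem IsArchimedeanCone.exists_pos (hQ : IsQuadraticModule Q) (hA : IsArchimedeanCone Q)
    (a : A) : ∃ c : ℝ, 0 < c ∧ c • (1 : A) - a ∈ Q := by
  obtain ⟨c, hc⟩ := hA a
  refine ⟨max c 1, by positivity, ?_⟩
  have := Q.add_mem hc (hQ.smul_one_mem (c := max c 1 - c) (by simp))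
  convert this using 1
  module

theorem IsArchimedeanCone.mem_of_neg_one_mem (hQ : IsQuadraticModule Q)
    (hA : IsArchimedeanCone Q) (h : (-1 : A) ∈ Q) (a : A) : a ∈ Q := by
  obtain ⟨c, hc, hca⟩ := hA.exists_pos hQ (-a)
  have := Q.add_mem hca (smul_mem_cone hc.le h)
  convert this using 1
  module

/-! ### States -/

/-- The cone generated by `Q` and `-f`. -/
def adjoinNeg (Q : PointedCone ℝ A) (f : A) : PointedCone ℝ A :=
  Q ⊔ Submodule.span _ {-f}

theorem mem_adjoinNeg {f a : A} :
    a ∈ adjoinNeg Q f ↔ ∃ q ∈ Q, ∃ t : ℝ, 0 ≤ t ∧ a = q - t • f := by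
  rw [adjoinNeg, Submodule.mem_sup]
  constructor
  · rintro ⟨q, hq, z, hz, rfl⟩
    obtain ⟨⟨t, ht⟩, rfl⟩ := Submodule.mem_span_singleton.1 hz
    refine ⟨q, hq, t, ht, ?_⟩
    change q + t • (-f) = _
    module
  · rintro ⟨q, hq, t, ht, rfl⟩
    refine ⟨q, hq, _, Submodule.mem_span_singleton.2 ⟨⟨t, ht⟩, rfl⟩, ?_⟩
    change q + t • (-f) = _
    module

/-- An element outside an Archimedean quadratic module is not positive at some state. -/
theorem exists_state_nonpos (hQ : IsQuadraticModule Q) (hA : IsArchimedeanCone Q) {f : A}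
    (hf : f ∉ Q) : ∃ L ∈ stateSet Q, L f ≤ 0 := by
  have hle : Q ≤ adjoinNeg Q f := le_sup_left
  have hneg : (-1 : A) ∉ adjoinNeg Q f := by
    rw [mem_adjoinNeg]
    rintro ⟨q, hq, t, ht, h⟩
    have htf : t • f ∈ Q := by
      have := Q.add_mem hq hQ.one_mem
      convert this using 1
      linear_combination h
    rcases ht.lt_or_eq with ht | rfl
    · refine hf ?_
      have := smul_mem_cone (inv_nonneg.2 ht.le) htf
      rwa [inv_smul_smul₀ ht.ne'] at this
    · rw [zero_smul, sub_zero] at h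
      exact hf (hA.mem_of_neg_one_mem hQ (h ▸ hq) f)
  have h1 : (1 : A) ≠ 0 := fun h => hneg (by rw [h, neg_zero]; exact Submodule.zero_mem _)
  have hval : ∀ (c : ℝ) (hc : c • (1 : A) ∈ (LinearPMap.mkSpanSingleton (K := ℝ) (L := ℝ)
      (σ := RingHom.id ℝ) (1 : A) (1 : ℝ) h1).domain),
      (LinearPMap.mkSpanSingleton (K := ℝ) (L := ℝ) (σ := RingHom.id ℝ) (1 : A) (1 : ℝ) h1)
        ⟨c • 1, hc⟩ = c := by
    intro c hc
    rw [LinearPMap.mkSpanSingleton'_apply]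
    simp
  -- Extend c • 1 ↦ c from ℝ • 1: it is nonnegative on the cone since -1 is not in it, and the
  -- Archimedean property gives the cofinality needed.
  obtain ⟨L, hL, hL0⟩ := riesz_extension (adjoinNeg Q f)
    (LinearPMap.mkSpanSingleton (K := ℝ) (L := ℝ) (σ := RingHom.id ℝ) (1 : A) (1 : ℝ) h1)
    (by
      rintro ⟨x, hx⟩ hxs
      obtain ⟨c, rfl⟩ := Submodule.mem_span_singleton.1 hx
      rw [hval]
      by_contra! hc
      have := smul_mem_cone (inv_nonneg.2 (neg_nonneg.2 hc.le)) hxs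
      rw [smul_smul, inv_neg, neg_mul, inv_mul_cancel₀ hc.ne, neg_smul, one_smul] at this
      exact hneg this)
    (by
      intro y
      obtain ⟨c, hc⟩ := hA (-y)
      refine ⟨⟨c • 1, Submodule.mem_span_singleton.2 ⟨c, rfl⟩⟩, hle ?_⟩
      simpa using hc)
  refine ⟨L, ⟨L.map_add, fun c a => by simp, ?_, fun q hq => hL0 q (hle hq)⟩, ?_⟩
  · have := (hL ⟨(1 : ℝ) • (1 : A), Submodule.mem_span_singleton.2 ⟨1, rfl⟩⟩).trans (hval 1 _)
    simpa using this
  · have := hL0 (-f) (mem_adjoinNeg.2 ⟨0, Q.zero_mem, 1, zero_le_one, by module⟩)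
    rw [map_neg] at this
    linarith

theorem stateSet_neg {L : A → ℝ} (hL : L ∈ stateSet Q) (a : A) : L (-a) = -L a := by
  have := hL.2.1 (-1) a
  rw [neg_one_smul] at this
  linarith

theorem stateSet_sub {L : A → ℝ} (hL : L ∈ stateSet Q) (a b : A) : L (a - b) = L a - L b := by
  rw [sub_eq_add_neg, hL.1, stateSet_neg hL, ← sub_eq_add_neg]

theorem stateSet_le {L : A → ℝ} (hL : L ∈ stateSet Q) {c : ℝ} {a : A}
    (h : c • (1 : A) - a ∈ Q) : L a ≤ c := by
  have := hL.2.2.2 _ h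
  rw [stateSet_sub hL, hL.2.1, hL.2.2.1] at this
  linarith

theorem isClosed_stateSet : IsClosed (stateSet Q) := by
  have : stateSet Q = (⋂ a, ⋂ b, {L | L (a + b) = L a + L b}) ∩
      ((⋂ c : ℝ, ⋂ a, {L | L (c • a) = c * L a}) ∩
        ({L | L 1 = 1} ∩ ⋂ q ∈ Q, {L | 0 ≤ L q})) := by
    ext L
    simp [stateSet]
  rw [this]
  refine IsClosed.inter ?_ (IsClosed.inter ?_ (IsClosed.inter ?_ ?_))
  · exact isClosed_iInter fun a => isClosed_iInter fun b =>
      isClosed_eq (by fun_prop) (by fun_prop)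
  · exact isClosed_iInter fun c => isClosed_iInter fun a =>
      isClosed_eq (by fun_prop) (by fun_prop)
  · exact isClosed_eq (by fun_prop) (by fun_prop)
  · exact isClosed_iInter fun q => isClosed_iInter fun _ =>
      isClosed_le (by fun_prop) (by fun_prop)

/-- Tychonoff: Archimedean bounds on `a` and `-a` confine each coordinate `L a` to a fixed interval.
-/
theorem isCompact_stateSet (hA : IsArchimedeanCone Q) : IsCompact (stateSet Q) := by
  choose c hc using hA
  refine (isCompact_univ_pi fun a => isCompact_Icc (a := -c (-a)) (b := c a)).of_isClosed_subset
    isClosed_stateSet ?_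
  intro L hL a _
  refine ⟨?_, stateSet_le hL (hc a)⟩
  have := stateSet_le hL (hc (-a))
  rw [stateSet_neg hL] at this
  linarith

/-! ### Extreme states and the Archimedean Positivstellensatz. -/

/-- A linear functional that is nonnegative on an Archimedean quadratic module and vanishes at `1`
is zero. -/
theorem eq_zero_of_map_one_eq_zero (hA : IsArchimedeanCone Q) {ℓ : A →ₗ[ℝ] ℝ}
    (hℓ : ∀ q ∈ Q, 0 ≤ ℓ q) (h1 : ℓ 1 = 0) (a : A) : ℓ a = 0 := by
  obtain ⟨c, hc⟩ := hA a
  obtain ⟨d, hd⟩ := hA (-a)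
  have h2 := hℓ _ hc
  have h3 := hℓ _ hd
  simp only [map_sub, map_smul, h1, map_neg, smul_zero] at h2 h3
  linarith

/-- The Cauchy–Schwarz inequality for functionals that are nonnegative on squares. -/
theorem cauchySchwarz_of_nonneg_sq {ℓ : A →ₗ[ℝ] ℝ} (hℓ : ∀ a, 0 ≤ ℓ (a * a)) (a b : A) :
    ℓ (a * b) * ℓ (a * b) ≤ ℓ (a * a) * ℓ (b * b) := by
  have h : ∀ t : ℝ, 0 ≤ ℓ (b * b) * (t * t) + 2 * ℓ (a * b) * t + ℓ (a * a) := by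
    intro t
    have h1 := hℓ (a + t • b)
    have h2 : (a + t • b) * (a + t • b) = a * a + (2 * t) • (a * b) + (t * t) • (b * b) := by
      simp only [Algebra.smul_def, map_mul, map_ofNat]
      ring
    rw [h2] at h1
    simp only [map_add, map_smul, smul_eq_mul] at h1
    linarith
  have := discrim_le_zero h
  rw [discrim] at this
  linarith

/-- If `ρ - s²` lies in an Archimedean quadratic module `Q` then a functional which is
nonnegative on `Q` satisfies `ℓ (s² q) ≤ ρ ℓ q` for all `q ∈ Q`. -/
theorem map_sq_mul_le (hQ : IsQuadraticModule Q) (hA : IsArchimedeanCone Q) {ℓ : A →ₗ[ℝ] ℝ}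
    (hℓ : ∀ q ∈ Q, 0 ≤ ℓ q) {s : A} {ρ : ℝ} (hρ : 0 < ρ) (hs : ρ • (1 : A) - s * s ∈ Q)
    {q : A} (hq : q ∈ Q) : ℓ (s * s * q) ≤ ρ * ℓ q := by
  obtain ⟨N, hN, hNq⟩ := hA.exists_pos hQ q
  have hpow : ∀ k : ℕ, ℓ (s ^ k * s ^ k) ≤ ℓ 1 * ρ ^ k := by
    intro k
    induction k with
    | zero => simp
    | succ k ih =>
      have h1 := hℓ _ (hQ.mul_self_mul_mem (s ^ k) _ hs)
      have h2 : s ^ k * s ^ k * (ρ • (1 : A) - s * s)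
          = ρ • (s ^ k * s ^ k) - s ^ (k + 1) * s ^ (k + 1) := by
        simp only [Algebra.smul_def]
        ring
      rw [h2, map_sub, map_smul, smul_eq_mul] at h1
      calc _ ≤ ρ * ℓ (s ^ k * s ^ k) := by linarith
        _ ≤ ρ * (ℓ 1 * ρ ^ k) := mul_le_mul_of_nonneg_left ih hρ.le
        _ = _ := by ring
  -- The product of ρ - s² and q need not lie in `Q`, so the bound is extracted from the growth of
  -- ℓ(s²ᵏq): log-convex by Cauchy–Schwarz for the form ℓ(abq), and at most N ℓ(1) ρᵏ because N - q
  -- ∈ `Q`.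
  have := le_mul_of_logConvex (u := fun k => ℓ (s ^ k * s ^ k * q)) (N := N * ℓ 1) hρ
    (fun k => hℓ _ (hQ.mul_self_mul_mem _ _ hq))
    (fun k => by
      have := cauchySchwarz_of_nonneg_sq (ℓ := ℓ ∘ₗ LinearMap.mulRight ℝ q)
        (fun a => hℓ _ (hQ.mul_self_mul_mem a _ hq)) (s ^ k) (s ^ (k + 2))
      simp only [LinearMap.comp_apply, LinearMap.mulRight_apply] at this
      rwa [show s ^ k * s ^ (k + 2) = s ^ (k + 1) * s ^ (k + 1) by ring] at this)
    (fun k => by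
      have h1 := hℓ _ (hQ.mul_self_mul_mem (s ^ k) _ hNq)
      have h2 : s ^ k * s ^ k * (N • (1 : A) - q)
          = N • (s ^ k * s ^ k) - s ^ k * s ^ k * q := by
        simp only [Algebra.smul_def]
        ring
      rw [h2, map_sub, map_smul, smul_eq_mul] at h1
      calc _ ≤ N * ℓ (s ^ k * s ^ k) := by linarith
        _ ≤ N * (ℓ 1 * ρ ^ k) := mul_le_mul_of_nonneg_left (hpow k) hN.le
        _ = _ := by ring)
  simpa using this

/-- Domination splits a multiple of `L` as L(s²·) plus a remainder, both nonnegative on `Q`. After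
normalization extremality forces L(s²·) to be proportional to `L`; if L(s²) = 0, then L(s²·)
vanishes identically. -/
theorem map_sq_mul_of_mem_extremePoints (hQ : IsQuadraticModule Q) (hA : IsArchimedeanCone Q)
    {L : A → ℝ} (hL : L ∈ (stateSet Q).extremePoints ℝ) (s b : A) :
    L (s * s * b) = L (s * s) * L b := by
  have hLs := hL.1
  let ℓ : A →ₗ[ℝ] ℝ := ⟨⟨L, hLs.1⟩, hLs.2.1⟩
  have hℓ : ∀ q ∈ Q, 0 ≤ ℓ q := hLs.2.2.2
  have hℓ1 : ℓ 1 = 1 := hLs.2.2.1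
  change ℓ (s * s * b) = ℓ (s * s) * ℓ b
  obtain ⟨ρ, hρ, hs⟩ := hA.exists_pos hQ (s * s)
  -- Using ρ + 1 instead of ρ gives the remainder a positive value at 1, so it can be normalized.
  have hlt : ℓ (s * s) < ρ + 1 := (stateSet_le hLs hs).trans_lt (lt_add_one ρ)
  let ℓ₁ : A →ₗ[ℝ] ℝ := ℓ ∘ₗ LinearMap.mulLeft ℝ (s * s)
  let ℓ₂ : A →ₗ[ℝ] ℝ := (ρ + 1) • ℓ - ℓ₁
  have h₁ : ∀ q ∈ Q, 0 ≤ ℓ₁ q := fun q hq => hℓ _ (hQ.mul_self_mul_mem s q hq)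
  have h₂ : ∀ q ∈ Q, 0 ≤ ℓ₂ q := by
    intro q hq
    have h3 := map_sq_mul_le hQ hA hℓ hρ hs hq
    have h4 := hℓ q hq
    change 0 ≤ (ρ + 1) * ℓ q - ℓ (s * s * q)
    linarith
  have hv₁ : ℓ₁ 1 = ℓ (s * s) := by simp [ℓ₁]
  have hv₂ : ℓ₂ 1 = ρ + 1 - ℓ (s * s) := by simp [ℓ₂, hv₁, hℓ1]
  have hs0 : 0 ≤ ℓ (s * s) := hℓ _ (hQ.mul_self_mem s)
  rcases hs0.lt_or_eq with hs0 | hs0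
  · have hw : 0 < ρ + 1 - ℓ (s * s) := by linarith
    have mem : ∀ (l : A →ₗ[ℝ] ℝ) (w : ℝ), (∀ q ∈ Q, 0 ≤ l q) → l 1 = w → 0 < w →
        (fun a => w⁻¹ * l a) ∈ stateSet Q := by
      intro l w hl hl1 hw
      refine ⟨fun a b => by simp [mul_add], fun c a => by simp; ring, ?_,
        fun q hq => mul_nonneg (inv_nonneg.2 hw.le) (hl q hq)⟩
      simp [hl1, hw.ne']
    have := (mem_extremePoints.1 hL).2 _ (mem ℓ₁ _ h₁ hv₁ hs0) _ (mem ℓ₂ _ h₂ hv₂ hw)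
      ⟨ℓ (s * s) / (ρ + 1), (ρ + 1 - ℓ (s * s)) / (ρ + 1), by positivity, by positivity,
        by field_simp; ring, by
          funext a
          change _ * (_ * ℓ₁ a) + _ * (_ * ((ρ + 1) * ℓ a - ℓ₁ a)) = ℓ a
          field_simp
          ring⟩
    have h5 := congrFun this.1 b
    change (ℓ (s * s))⁻¹ * ℓ (s * s * b) = ℓ b at h5
    rw [← h5]
    field_simp
  · have := eq_zero_of_map_one_eq_zero hA h₁ (hv₁.trans hs0.symm) b
    rw [← hs0, zero_mul]
    exact this

/-- The extreme states of an Archimedean quadratic module are multiplicative. -/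
theorem map_mul_of_mem_extremePoints (hQ : IsQuadraticModule Q) (hA : IsArchimedeanCone Q)
    {L : A → ℝ} (hL : L ∈ (stateSet Q).extremePoints ℝ) (a b : A) :
    L (a * b) = L a * L b := by
  have hLs := hL.1
  -- Polarization: 4a = (a + 1)² - (a - 1)².
  have h1 := map_sq_mul_of_mem_extremePoints hQ hA hL (a + 1) b
  have h2 := map_sq_mul_of_mem_extremePoints hQ hA hL (a - 1) b
  have h3 : (a + 1) * (a + 1) = (a - 1) * (a - 1) + (4 : ℝ) • a := by
    rw [Algebra.smul_def, map_ofNat]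
    ring
  have h4 : (a + 1) * (a + 1) * b = (a - 1) * (a - 1) * b + (4 : ℝ) • (a * b) := by
    rw [h3, add_mul, smul_mul_assoc]
  rw [h4, h3, hLs.1, hLs.1, hLs.2.1, hLs.2.1, h2] at h1
  linarith

/-- **Archimedean Positivstellensatz**: an element which is positive at all characters that are
nonnegative on an Archimedean quadratic module belongs to it. -/
theorem mem_of_forall_algHom_pos (hQ : IsQuadraticModule Q) (hA : IsArchimedeanCone Q) {f : A}
    (hf : ∀ χ : A →ₐ[ℝ] ℝ, (∀ q ∈ Q, 0 ≤ χ q) → 0 < χ f) : f ∈ Q := by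
  by_contra hfQ
  obtain ⟨L₀, hL₀, hL₀f⟩ := exists_state_nonpos hQ hA hfQ
  have hcpt := isCompact_stateSet hA
  -- The states minimizing the value at `f` form an exposed face; its extreme points are extreme in
  -- the whole state set.
  let l : StrongDual ℝ (A → ℝ) := -ContinuousLinearMap.proj (R := ℝ) (φ := fun _ : A => ℝ) f
  have hexp : IsExposed ℝ (stateSet Q) (l.toExposed (stateSet Q)) :=
    ContinuousLinearMap.toExposed.isExposed
  obtain ⟨L₁, hL₁, hmin⟩ := hcpt.exists_isMaxOn ⟨L₀, hL₀⟩ l.continuous.continuousOn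
  obtain ⟨L, hL⟩ := (hexp.isCompact hcpt).extremePoints_nonempty ⟨L₁, hL₁, fun y hy => hmin hy⟩
  have hLf : L f ≤ 0 := by
    have := hL.1.2 L₀ hL₀
    change -L₀ f ≤ -L f at this
    linarith
  have hext := hexp.isExtreme.extremePoints_subset_extremePoints hL
  have hLs := hext.1
  let ℓ : A →ₗ[ℝ] ℝ := ⟨⟨L, hLs.1⟩, hLs.2.1⟩
  let χ : A →ₐ[ℝ] ℝ :=
    AlgHom.ofLinearMap ℓ hLs.2.2.1 (map_mul_of_mem_extremePoints hQ hA hext)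
  exact absurd (hf χ hLs.2.2.2) (not_lt.2 hLf)

/-! ### Archimedean quadratic modules of polynomial rings -/

/-- The elements bounded in absolute value with respect to a quadratic module form a subalgebra. -/
def boundedSubalgebra (hQ : IsQuadraticModule Q) : Subalgebra ℝ A :=
  have hadd : ∀ {a b : A}, (∃ c : ℝ, 0 < c ∧ c • (1 : A) - a ∈ Q ∧ c • (1 : A) + a ∈ Q) →
      (∃ c : ℝ, 0 < c ∧ c • (1 : A) - b ∈ Q ∧ c • (1 : A) + b ∈ Q) →
      ∃ c : ℝ, 0 < c ∧ c • (1 : A) - (a + b) ∈ Q ∧ c • (1 : A) + (a + b) ∈ Q := by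
    rintro a b ⟨c, hc, h1, h2⟩ ⟨d, hd, h3, h4⟩
    refine ⟨c + d, by positivity, ?_, ?_⟩
    · convert Q.add_mem h1 h3 using 1
      module
    · convert Q.add_mem h2 h4 using 1
      module
  have hneg : ∀ {a : A}, (∃ c : ℝ, 0 < c ∧ c • (1 : A) - a ∈ Q ∧ c • (1 : A) + a ∈ Q) →
      ∃ c : ℝ, 0 < c ∧ c • (1 : A) - (-a) ∈ Q ∧ c • (1 : A) + (-a) ∈ Q := by
    rintro a ⟨c, hc, h1, h2⟩
    exact ⟨c, hc, by rwa [sub_neg_eq_add], by rwa [← sub_eq_add_neg]⟩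
  have hsq : ∀ {a : A} (t : ℝ), 0 ≤ t →
      (∃ c : ℝ, 0 < c ∧ c • (1 : A) - a ∈ Q ∧ c • (1 : A) + a ∈ Q) →
      ∃ c : ℝ, 0 < c ∧ c • (1 : A) - t • (a * a) ∈ Q ∧ c • (1 : A) + t • (a * a) ∈ Q := by
    rintro a t ht ⟨c, hc, h1, h2⟩
    refine ⟨t * (c * c) + 1, by positivity, ?_, Q.add_mem (hQ.smul_one_mem (by positivity))
      (smul_mem_cone ht (hQ.mul_self_mem a))⟩
    -- `Q` is not closed under products, so c² - a² is obtained from square multiples of c + a and c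
    -- - a.
    have h4 : (c • (1 : A) - a) * (c • (1 : A) - a) * (c • (1 : A) + a)
        + (c • (1 : A) + a) * (c • (1 : A) + a) * (c • (1 : A) - a)
        = (2 * c) • ((c * c) • (1 : A) - a * a) := by
      simp only [Algebra.smul_def, map_mul, map_ofNat]
      ring
    have h3 := smul_mem_cone (c := t * (2 * c)⁻¹) (by positivity)
      (Q.add_mem (hQ.mul_self_mul_mem (c • (1 : A) - a) _ h2)
        (hQ.mul_self_mul_mem (c • (1 : A) + a) _ h1))
    rw [h4, smul_smul, inv_mul_cancel_right₀ (by positivity)] at h3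
    convert Q.add_mem h3 hQ.one_mem using 1
    module
  { carrier := {a | ∃ c : ℝ, 0 < c ∧ c • (1 : A) - a ∈ Q ∧ c • (1 : A) + a ∈ Q}
    mul_mem' := by
      intro a b ha hb
      have h1 := hadd (hsq (1 / 4) (by norm_num) (hadd ha hb))
        (hneg (hsq (1 / 4) (by norm_num) (hadd ha (hneg hb))))
      have h2 : (1 / 4 : ℝ) • ((a + b) * (a + b)) + -((1 / 4 : ℝ) • ((a + -b) * (a + -b)))
          = a * b := by
        rw [← sub_eq_add_neg, ← smul_sub, show (a + b) * (a + b) - (a + -b) * (a + -b)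
          = (4 : ℝ) • (a * b) by rw [Algebra.smul_def, map_ofNat]; ring, smul_smul]
        norm_num
      rwa [h2] at h1
    add_mem' := hadd
    algebraMap_mem' := by
      intro r
      refine ⟨|r| + 1, by positivity, ?_, ?_⟩
      · rw [Algebra.algebraMap_eq_smul_one, ← sub_smul]
        exact hQ.smul_one_mem (by linarith [le_abs_self r])
      · rw [Algebra.algebraMap_eq_smul_one, ← add_smul]
        exact hQ.smul_one_mem (by linarith [neg_abs_le r]) }

theorem isArchimedeanCone_of_adjoin_eq_top (hQ : IsQuadraticModule Q) {S : Set A}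
    (hS : Algebra.adjoin ℝ S = ⊤) (c : ℝ) (h : ∀ s ∈ S, c • (1 : A) - s * s ∈ Q) :
    IsArchimedeanCone Q := by
  have hle : Algebra.adjoin ℝ S ≤ boundedSubalgebra hQ := by
    refine Algebra.adjoin_le fun s hs => ?_
    have hb : ∀ a : A, c • (1 : A) - a * a ∈ Q →
        ((|c| + 1) / 2) • (1 : A) - a ∈ Q := by
      intro a ha
      -- (c - a²) + (a - 1)² = c + 1 - 2a; the extra constant (|c| - c)/2 makes the bound positive
      -- for either sign of `c`.
      have := Q.add_mem (smul_mem_cone (c := 1 / 2) (by norm_num)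
        (Q.add_mem ha (hQ.mul_self_mem (a - 1))))
        (hQ.smul_one_mem (c := (|c| - c) / 2) (by linarith [le_abs_self c]))
      convert this using 1
      rw [show (a - 1) * (a - 1) = a * a - (2 : ℝ) • a + (1 : ℝ) • 1 by
        rw [Algebra.smul_def, map_ofNat]; simp; ring]
      module
    refine ⟨(|c| + 1) / 2, by positivity, hb s (h s hs), ?_⟩
    have := hb (-s) (by rw [neg_mul_neg]; exact h s hs)
    rwa [sub_neg_eq_add] at this
  intro a
  obtain ⟨d, -, hd, -⟩ := hle (hS ▸ Algebra.mem_top (x := a))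
  exact ⟨d, hd⟩

end QuadraticModule

/-! ### The quadratic module of ℝ[x, √p], pulled back to polynomials. -/

namespace SqrtAlgebra

variable {n m : ℕ} {p : MvPolynomial (Fin n) ℝ}

theorem subst_add (a b : MvPolynomial (Fin (n + 1)) ℝ) (x : Domain p) :
    subst p (a + b) x = subst p a x + subst p b x := by
  simp [subst]

theorem subst_mul (a b : MvPolynomial (Fin (n + 1)) ℝ) (x : Domain p) :
    subst p (a * b) x = subst p a x * subst p b x := by
  simp [subst]

theorem subst_smul (c : ℝ) (a : MvPolynomial (Fin (n + 1)) ℝ) (x : Domain p) :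
    subst p (c • a) x = c * subst p a x := by
  simp [subst, MvPolynomial.smul_eval]

@[simp]
theorem generators_castSucc (i : Fin n) (x : Domain p) :
    generators p i.castSucc x = x.1 i := by
  simp [generators]

@[simp]
theorem generators_last (x : Domain p) :
    generators p (Fin.last n) x = Real.sqrt (polyFun p x) := by
  simp [generators]

/-- Every element of `ℝ[x, √p(x)]` is of the form `h(x, √p(x))` with a polynomial `h`. -/
theorem exists_subst_eq {f : Domain p → ℝ} (hf : f ∈ sqrtAlgebra p) :
    ∃ h : MvPolynomial (Fin (n + 1)) ℝ, ∀ x, subst p h x = f x := by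
  rw [sqrtAlgebra, Algebra.adjoin_range_eq_range_aeval] at hf
  obtain ⟨h, rfl⟩ := hf
  refine ⟨h, fun x => ?_⟩
  induction h using MvPolynomial.induction_on with
  | C a => simp [subst]
  | add a b ha hb => rw [subst_add, ha, hb]; simp
  | mul_X a i ha => rw [subst_mul, ha]; simp [subst]

/-- `h` represents on `X` an element of the quadratic module generated by `M - ‖x‖² - p`, the
constraint functions and `√p`. -/
def IsRepresented (p : MvPolynomial (Fin n) ℝ) (g : Fin m → Domain p → ℝ) (M : ℝ)
    (h : MvPolynomial (Fin (n + 1)) ℝ) : Prop :=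
  ∃ (σ σ₀ φ : MvPolynomial (Fin (n + 1)) ℝ)
    (ψ : Fin (m + 1) → MvPolynomial (Fin (n + 1)) ℝ),
    IsSumSq σ ∧ IsSumSq σ₀ ∧ IsSumSq φ ∧ (∀ j, IsSumSq (ψ j)) ∧
    ∀ x : Domain p,
      subst p h x = subst p σ x
        + (M - ‖x.1‖ ^ 2 - polyFun p x) * subst p σ₀ x
        + ∑ j, constraints p g j x * subst p (ψ j) x
        + Real.sqrt (polyFun p x) * subst p φ x

theorem isSumSq_smul {A : Type*} [CommRing A] [Algebra ℝ A] {c : ℝ} (hc : 0 ≤ c) {a : A}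
    (ha : IsSumSq a) : IsSumSq (c • a) := by
  have h : c • a = algebraMap ℝ A (Real.sqrt c) * algebraMap ℝ A (Real.sqrt c) * a := by
    rw [← map_mul, Real.mul_self_sqrt hc, Algebra.smul_def]
  rw [h]
  exact (IsSumSq.mul_self _).mul ha

/-- The quadratic module of the polynomials that represent on `X` an element of the quadratic
module generated by `M - ‖x‖² - p`, the constraint functions and `√p`. -/
def representedCone (p : MvPolynomial (Fin n) ℝ) (g : Fin m → Domain p → ℝ) (M : ℝ) :
    PointedCone ℝ (MvPolynomial (Fin (n + 1)) ℝ) where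
  carrier := {h | IsRepresented p g M h}
  zero_mem' := ⟨0, 0, 0, 0, .zero, .zero, .zero, fun _ => .zero, by simp [subst]⟩
  add_mem' := by
    rintro a b ⟨σ, σ₀, φ, ψ, h1, h2, h3, h4, h⟩ ⟨σ', σ₀', φ', ψ', h1', h2', h3', h4', h'⟩
    refine ⟨σ + σ', σ₀ + σ₀', φ + φ', ψ + ψ', h1.add h1', h2.add h2', h3.add h3',
      fun j => (h4 j).add (h4' j), fun x => ?_⟩
    simp only [subst_add, h x, h' x, Pi.add_apply, mul_add, Finset.sum_add_distrib]
    ring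
  smul_mem' := by
    rintro ⟨c, hc⟩ a ⟨σ, σ₀, φ, ψ, h1, h2, h3, h4, h⟩
    refine ⟨c • σ, c • σ₀, c • φ, c • ψ, isSumSq_smul hc h1, isSumSq_smul hc h2,
      isSumSq_smul hc h3, fun j => isSumSq_smul hc (h4 j), fun x => ?_⟩
    change subst p (c • a) x = _
    simp only [subst_smul, h x, Pi.smul_apply, mul_add, Finset.mul_sum, mul_left_comm c]

theorem isQuadraticModule_representedCone (g : Fin m → Domain p → ℝ) (M : ℝ) :
    IsQuadraticModule (representedCone p g M) where
  one_mem := ⟨1, 0, 0, 0, .one, .zero, .zero, fun _ => .zero, by simp [subst]⟩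
  mul_self_mul_mem := by
    rintro s a ⟨σ, σ₀, φ, ψ, h1, h2, h3, h4, h⟩
    have hs := IsSumSq.mul_self s
    refine ⟨s * s * σ, s * s * σ₀, s * s * φ, fun j => s * s * ψ j, hs.mul h1, hs.mul h2,
      hs.mul h3, fun j => hs.mul (h4 j), fun x => ?_⟩
    simp only [subst_mul, h x, mul_add, Finset.mul_sum,
      mul_left_comm (subst p s x * subst p s x)]

/-- Applied to a relation and its negative, this forces every character nonnegative on the cone to
respect the relation. -/
theorem mem_representedCone_of_subst_eq_zero (g : Fin m → Domain p → ℝ) (M : ℝ)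
    {h : MvPolynomial (Fin (n + 1)) ℝ} (hh : ∀ x, subst p h x = 0) :
    h ∈ representedCone p g M :=
  ⟨0, 0, 0, 0, .zero, .zero, .zero, fun _ => .zero, fun x => by rw [hh x]; simp [subst]⟩

theorem mem_representedCone_of_subst_eq_constraints {g : Fin m → Domain p → ℝ} (M : ℝ)
    {h : MvPolynomial (Fin (n + 1)) ℝ} (j : Fin (m + 1))
    (hh : ∀ x, subst p h x = constraints p g j x) : h ∈ representedCone p g M := by
  refine ⟨0, 0, 0, Pi.single j 1, .zero, .zero, .zero, fun i => ?_, fun x => ?_⟩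
  · rcases eq_or_ne i j with rfl | hij
    · simp
    · rw [Pi.single_eq_of_ne hij]
      exact .zero
  · rw [Finset.sum_eq_single j (fun i _ hij => by simp [Pi.single_eq_of_ne hij, subst])
      (by simp), hh x]
    simp [subst]

theorem X_last_mem_representedCone (g : Fin m → Domain p → ℝ) (M : ℝ) :
    MvPolynomial.X (Fin.last n) ∈ representedCone p g M :=
  ⟨0, 0, 1, 0, .zero, .zero, .one, fun _ => .zero, fun x => by simp [subst]⟩

/-- The last variable becomes √p, whose square supplies the term -p beside -‖x‖². -/
theorem sub_sum_X_sq_mem_representedCone (g : Fin m → Domain p → ℝ) (M : ℝ) :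
    M • (1 : MvPolynomial (Fin (n + 1)) ℝ) - ∑ i, MvPolynomial.X i * MvPolynomial.X i
      ∈ representedCone p g M := by
  refine ⟨0, 1, 0, 0, .zero, .one, .zero, fun _ => .zero, fun x => ?_⟩
  have hx : Real.sqrt (polyFun p x) * Real.sqrt (polyFun p x) = polyFun p x :=
    Real.mul_self_sqrt x.2
  rw [EuclideanSpace.real_norm_sq_eq]
  simp only [subst, map_sub, map_add, MvPolynomial.smul_eval, map_one, map_sum, map_mul,
    MvPolynomial.eval_X, Fin.sum_univ_castSucc, generators_castSucc, generators_last, hx,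
    Pi.zero_apply, map_zero, mul_zero, Finset.sum_const_zero,
    sq]
  ring

theorem isArchimedeanCone_representedCone (g : Fin m → Domain p → ℝ) (M : ℝ) :
    IsArchimedeanCone (representedCone p g M) := by
  have hQ := isQuadraticModule_representedCone g M
  refine isArchimedeanCone_of_adjoin_eq_top hQ (MvPolynomial.adjoin_range_X) M ?_
  rintro _ ⟨i, rfl⟩
  have h1 : ∑ j ∈ Finset.univ.erase i, MvPolynomial.X j * MvPolynomial.X j
      ∈ representedCone p g M :=
    Submodule.sum_mem _ fun j _ => hQ.mul_self_mem _
  -- Adding back the squares of the other variables leaves M - yᵢ².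
  convert Submodule.add_mem _ (sub_sum_X_sq_mem_representedCone g M) h1 using 1
  rw [← Finset.add_sum_erase Finset.univ _ (Finset.mem_univ i)]
  ring

/-- The characters which are nonnegative on `representedCone` are evaluations at points of the
constraint set. -/
theorem exists_point_of_algHom {g : Fin m → Domain p → ℝ} (hg : ∀ j, g j ∈ sqrtAlgebra p) {M : ℝ}
    (χ : MvPolynomial (Fin (n + 1)) ℝ →ₐ[ℝ] ℝ) (hχ : ∀ q ∈ representedCone p g M, 0 ≤ χ q) :
    ∃ x ∈ constraintSet p g, ∀ h, χ h = subst p h x := by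
  let P : MvPolynomial (Fin (n + 1)) ℝ := MvPolynomial.rename Fin.castSucc p
  have hP : ∀ x : Domain p, subst p P x = polyFun p x := by
    intro x
    simp only [P, subst, MvPolynomial.eval_rename, polyFun]
    congr 2
    funext i
    simp
  have hval : ∀ h, χ h = MvPolynomial.eval (fun i => χ (MvPolynomial.X i)) h := by
    intro h
    rw [← MvPolynomial.coe_aeval_eq_eval]
    exact congrArg (· h) (MvPolynomial.aeval_unique χ)
  have hχP : χ P = MvPolynomial.eval (fun i => χ (MvPolynomial.X (Fin.castSucc i))) p := by
    rw [hval, MvPolynomial.eval_rename]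
    rfl
  have hsq : χ (MvPolynomial.X (Fin.last n)) * χ (MvPolynomial.X (Fin.last n)) = χ P := by
    have h0 : ∀ x : Domain p,
        subst p (MvPolynomial.X (Fin.last n) * MvPolynomial.X (Fin.last n)) x = subst p P x := by
      intro x
      rw [hP, subst_mul]
      simpa [subst] using Real.mul_self_sqrt (show 0 ≤ polyFun p x from x.2)
    have h1 := hχ (MvPolynomial.X (Fin.last n) * MvPolynomial.X (Fin.last n) + (-1 : ℝ) • P)
      (mem_representedCone_of_subst_eq_zero g M fun x => by
        rw [subst_add, subst_smul, h0]; ring)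
    have h2 := hχ (P + (-1 : ℝ) • (MvPolynomial.X (Fin.last n) * MvPolynomial.X (Fin.last n)))
      (mem_representedCone_of_subst_eq_zero g M fun x => by
        rw [subst_add, subst_smul, h0]; ring)
    simp only [map_add, map_smul, map_mul, smul_eq_mul] at h1 h2
    linarith
  have hlast : 0 ≤ χ (MvPolynomial.X (Fin.last n)) := hχ _ (X_last_mem_representedCone g M)
  -- The point lies in X because p there equals the square of χ(yₙ₊₁); the sign `hlast` then
  -- identifies χ(yₙ₊₁) with √p rather than -√p.
  let x : Domain p := ⟨WithLp.toLp 2 fun i => χ (MvPolynomial.X (Fin.castSucc i)), by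
    change 0 ≤ MvPolynomial.eval (fun i => χ (MvPolynomial.X (Fin.castSucc i))) p
    rw [← hχP, ← hsq]
    exact mul_self_nonneg _⟩
  have hx : ∀ h, χ h = subst p h x := by
    intro h
    rw [hval, subst]
    congr 2
    funext i
    refine Fin.lastCases ?_ (fun i => ?_) i
    · have hpx : polyFun p x = χ P := hχP.symm
      rw [generators_last, hpx, ← hsq, Real.sqrt_mul_self hlast]
    · rw [generators_castSucc]
  refine ⟨x, fun j => ?_, hx⟩
  have hlift : ∃ h, ∀ x, subst p h x = constraints p g j x := by
    refine Fin.lastCases ⟨P, fun x => ?_⟩ (fun j => ?_) j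
    · simp [constraints, hP]
    · simpa [constraints] using exists_subst_eq (hg j)
  obtain ⟨h, hh⟩ := hlift
  rw [← hh x, ← hx]
  exact hχ h (mem_representedCone_of_subst_eq_constraints M j hh)

end SqrtAlgebra

theorem mainTheorem11 (n m : ℕ) (p : MvPolynomial (Fin n) ℝ)
    (g : Fin m → SqrtAlgebra.Domain p → ℝ)
    (hg : ∀ j, g j ∈ SqrtAlgebra.sqrtAlgebra p)
    (M : ℝ)
    (hM : ∀ x ∈ SqrtAlgebra.constraintSet p g,
      0 < M - ‖x.1‖ ^ 2 - SqrtAlgebra.polyFun p x)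
    (f : SqrtAlgebra.Domain p → ℝ)
    (hf : f ∈ SqrtAlgebra.sqrtAlgebra p)
    (hpos : ∀ x ∈ SqrtAlgebra.constraintSet p g, 0 < f x) :
    ∃ (σ σ₀ φ : MvPolynomial (Fin (n + 1)) ℝ)
      (ψ : Fin (m + 1) → MvPolynomial (Fin (n + 1)) ℝ),
      IsSumSq σ ∧ IsSumSq σ₀ ∧ IsSumSq φ ∧ (∀ j, IsSumSq (ψ j)) ∧
      ∀ x : SqrtAlgebra.Domain p,
        f x = SqrtAlgebra.subst p σ x
          + (M - ‖x.1‖ ^ 2 - SqrtAlgebra.polyFun p x) * SqrtAlgebra.subst p σ₀ x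
          + ∑ j, SqrtAlgebra.constraints p g j x * SqrtAlgebra.subst p (ψ j) x
          + Real.sqrt (SqrtAlgebra.polyFun p x) * SqrtAlgebra.subst p φ x := by
  obtain ⟨h, hh⟩ := SqrtAlgebra.exists_subst_eq hf
  have hmem : h ∈ SqrtAlgebra.representedCone p g M :=
    mem_of_forall_algHom_pos (SqrtAlgebra.isQuadraticModule_representedCone g M)
      (SqrtAlgebra.isArchimedeanCone_representedCone g M) fun χ hχ => by
        obtain ⟨x, hx, hval⟩ := SqrtAlgebra.exists_point_of_algHom hg χ hχ
        rw [hval, hh]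
        exact hpos x hx
  obtain ⟨σ, σ₀, φ, ψ, h1, h2, h3, h4, h5⟩ := hmem
  exact ⟨σ, σ₀, φ, ψ, h1, h2, h3, h4, fun x => by rw [← hh x, h5 x]⟩
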